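/- Let $E$ be a real locally convex space and $A\subseteq E$. Let $M(A)$ be the set of Borel probability measures on $A$ with the topology of weak convergence. A point $x\in E$ is the barycenter $\mathbf b(\mu)$ of $\mu\in M(A)$ if it is the Pettis integral $\int_A a\,\mu(da)$, that is, every continuous linear functional $\ell$ on $E$ is $\mu$-integrable over $A$ and $\ell(x)=\int_A \ell\,d\mu$. The set $A$ is called $\mu$-compact if every $\mu\in M(A)$ has a unique barycenter, this barycenter lies in the closed convex hull $\overline{\mathrm{co}}\,A$, and for every compact $K\subseteq\overline{\mathrm{co}}\,A$ the set $\{\mu\in M(A) : \mathbf b(\mu)\in K\}$ is compact in $M(A)$. For a topological space $X$, equip the vector space of finite signed Borel measures on $X$ with the weak topology, i.e. the coarsest topology for which $\nu\mapsto\int_X f\,d\nu$ is continuous for every bounded continuous $f:X\to\mathbb R$. 1. Let $X$ be a complete separable metric space and let $M$ be a weakly closed set of finite nonnegative Borel measures on $X$ which is bounded in variation, i.e. $\sup_{\nu\in M}|\nu|(X)<\infty$. Then $M$ is $\mu$-compact in the weak topology. 2. If $X$ is a Polish space, then the set of all Borel probability measures on $X$ is $\mu$-compact in the weak topology. -/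

import Mathlib

open MeasureTheory Set
open scoped BoundedContinuousFunction NNReal ENNReal

noncomputable section

/-- `x` is the barycenter of the Borel probability measure `μ` on the subset `A` of the locally
convex space `E`: it is the Pettis integral `∫ a ∂μ`, i.e. every continuous linear functional `ℓ`
is `μ`-integrable on `A`, with integral `ℓ x`. -/
def IsBarycenter {E : Type*} [AddCommGroup E] [Module ℝ E] [TopologicalSpace E]
    [MeasurableSpace E] {A : Set E} (μ : ProbabilityMeasure A) (x : E) : Prop :=
  ∀ ℓ : E →L[ℝ] ℝ, Integrable (fun a : A => ℓ (a : E)) (μ : Measure A) ∧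
    ∫ a : A, ℓ (a : E) ∂(μ : Measure A) = ℓ x

/-- `A` is `μ`-compact: the barycenter map from the Borel probability measures on `A` (with the
topology of weak convergence) to the closed convex hull of `A` is well defined, and its preimages
of compact sets are compact. -/
structure IsMuCompact {E : Type*} [AddCommGroup E] [Module ℝ E] [TopologicalSpace E]
    [IsTopologicalAddGroup E] [ContinuousSMul ℝ E] [LocallyConvexSpace ℝ E]
    [MeasurableSpace E] [BorelSpace E] (A : Set E) : Prop where
  existsUnique_barycenter : ∀ μ : ProbabilityMeasure A, ∃! x : E, IsBarycenter μ x
  barycenter_mem : ∀ (μ : ProbabilityMeasure A) (x : E), IsBarycenter μ x →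
    x ∈ closedConvexHull ℝ A
  isCompact_preimage : ∀ K : Set E, K ⊆ closedConvexHull ℝ A → IsCompact K →
    IsCompact {μ : ProbabilityMeasure A | ∃ x ∈ K, IsBarycenter μ x}

/-- A bounded continuous function is integrable with respect to a finite signed measure. -/
theorem integrable_signedMeasure {X : Type*} [TopologicalSpace X] [MeasurableSpace X]
    [OpensMeasurableSpace X] (ν : SignedMeasure X) (f : X →ᵇ ℝ) :
    VectorMeasure.Integrable ν f := by
  have : IsFiniteMeasure ν.variation := by
    rw [← SignedMeasure.totalVariation_eq_variation]
    unfold SignedMeasure.totalVariation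
    infer_instance
  exact f.integrable _

/-- The pairing `(ν, f) ↦ ∫ f dν` of finite signed Borel measures with bounded continuous
functions. -/
def measurePairing (X : Type*) [TopologicalSpace X] [MeasurableSpace X] [OpensMeasurableSpace X] :
    SignedMeasure X →ₗ[ℝ] (X →ᵇ ℝ) →ₗ[ℝ] ℝ :=
  LinearMap.mk₂ ℝ (fun ν f => ∫ᵛ x, f x ∂•ν)
    (fun ν₁ ν₂ f => VectorMeasure.integral_add_vectorMeasure
      (integrable_signedMeasure ν₁ f) (integrable_signedMeasure ν₂ f))
    (fun c ν f => VectorMeasure.integral_smul_vectorMeasure f c)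
    (fun ν f g => VectorMeasure.integral_fun_add
      (integrable_signedMeasure ν f) (integrable_signedMeasure ν g))
    (fun c ν f => VectorMeasure.integral_fun_smul ν _ c f)

/-- The locally convex space of finite signed Borel measures on `X` with the weak topology: the
coarsest one for which `ν ↦ ∫ f dν` is continuous for every bounded continuous `f`. -/
abbrev WeakSignedMeasure (X : Type*) [TopologicalSpace X] [MeasurableSpace X]
    [OpensMeasurableSpace X] : Type _ :=
  WeakBilin (measurePairing X)

instance WeakSignedMeasure.instMeasurableSpace (X : Type*) [TopologicalSpace X]
    [MeasurableSpace X] [OpensMeasurableSpace X] : MeasurableSpace (WeakSignedMeasure X) :=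
  borel _

instance WeakSignedMeasure.instBorelSpace (X : Type*) [TopologicalSpace X]
    [MeasurableSpace X] [OpensMeasurableSpace X] : BorelSpace (WeakSignedMeasure X) :=
  ⟨rfl⟩

/-- The signed measure underlying a point of the weak space. -/
def WeakSignedMeasure.toSigned {X : Type*} [TopologicalSpace X] [MeasurableSpace X]
    [OpensMeasurableSpace X] (ν : WeakSignedMeasure X) : SignedMeasure X :=
  ν

end

/-! The barycenter of `μ` is the averaged measure `B ↦ ∫ ν(B) μ(dν)`: continuous functionals on the
weak space are exactly `ν ↦ ∫ f dν`, and these are bounded on `M` (`isBarycenter_iff`). Hahn-Banach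
puts it in the closed convex hull. Compactness is Prokhorov's theorem used on two levels. A compact
`K` in the hull consists of nonnegative measures, hence is uniformly tight on `X`. If the average of
`μ` lies in `K`, Markov's inequality makes most `ν`, with respect to `μ`, satisfy common tail
bounds; these `ν` form a compact part of `M`. So such `μ` are tight on `M`
(`isTightMeasureSet_of_average_mem`), and they form a closed set as averaging is continuous. -/

open Filter Topology TopologicalSpace ProbabilityTheory

/-! ### Finite Borel measures: comparison, measurability, tightness -/

section Measures

variable {X : Type*} [TopologicalSpace X] [MeasurableSpace X] [BorelSpace X]

/-- Domination of integrals of nonnegative bounded continuous functions implies domination of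
finite Borel measures on a pseudometrizable space. -/
theorem measure_le_of_forall_lintegral_le [PseudoMetrizableSpace X] {μ ν : Measure X}
    [IsFiniteMeasure μ] [IsFiniteMeasure ν]
    (h : ∀ f : X →ᵇ ℝ≥0, ∫⁻ x, f x ∂μ ≤ ∫⁻ x, f x ∂ν) : μ ≤ ν := by
  have hclosed : ∀ F : Set X, IsClosed F → μ F ≤ ν F := fun F hF =>
    ge_of_tendsto (HasOuterApproxClosed.tendsto_lintegral_apprSeq hF ν) (.of_forall fun n =>
      (HasOuterApproxClosed.measure_le_lintegral hF μ n).trans (h _))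
  refine Measure.le_iff.2 fun s hs => ?_
  rw [hs.measure_eq_iSup_isClosed_of_ne_top (measure_ne_top μ s)]
  exact iSup₂_le fun F hFs => iSup_le fun hF => (hclosed F hF).trans (measure_mono hFs)

/-- A weakly continuous family of finite Borel measures is measurable. -/
theorem FiniteMeasure.measurable_toMeasure_of_continuous [HasOuterApproxClosed X]
    {α : Type*} [TopologicalSpace α] [MeasurableSpace α] [OpensMeasurableSpace α]
    {g : α → FiniteMeasure X} (hg : Continuous g) : Measurable fun a => (g a : Measure X) := by
  have hclosed : ∀ F : Set X, IsClosed F → Measurable fun a => (g a : Measure X) F := fun F hF =>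
    measurable_of_tendsto_metrizable
      (fun n => (FiniteMeasure.continuous_iff_forall_continuous_lintegral.1 hg _).measurable)
      (tendsto_pi_nhds.2 fun a => HasOuterApproxClosed.tendsto_lintegral_apprSeq hF _)
  exact .measure_of_isPiSystem (BorelSpace.measurable_eq.trans borel_eq_generateFrom_isClosed)
    isPiSystem_isClosed hclosed (hclosed _ isClosed_univ)

/-- A compact set of finite Borel measures on a Polish space is uniformly tight. -/
theorem FiniteMeasure.exists_isCompact_forall_compl_le [PolishSpace X] {K : Set (FiniteMeasure X)}
    (hK : IsCompact K) {ε : ℝ≥0} (hε : 0 < ε) :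
    ∃ C : Set X, IsCompact C ∧ ∀ μ ∈ K, μ Cᶜ ≤ ε := by
  rcases isEmpty_or_nonempty X with hX | hX
  · exact ⟨∅, isCompact_empty, fun μ _ => by
      simp [show μ = 0 from Subtype.ext (Measure.eq_zero_of_isEmpty _)]⟩
  let := upgradeIsCompletelyMetrizable X
  obtain ⟨B, hB⟩ := (hK.image FiniteMeasure.continuous_mass).bddAbove
  replace hB : ∀ μ ∈ K, μ.mass ≤ B := fun μ hμ => hB (mem_image_of_mem _ hμ)
  -- Normalization is discontinuous at the zero measure, so only masses at least `ε` are normalized;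
  -- smaller ones satisfy the bound trivially.
  have hL : IsCompact (K ∩ {μ | ε ≤ μ.mass}) :=
    hK.inter_right (isClosed_le continuous_const FiniteMeasure.continuous_mass)
  have hne : ∀ μ ∈ K ∩ {μ | ε ≤ μ.mass}, μ ≠ 0 := fun μ hμ =>
    μ.mass_nonzero_iff.1 (hε.trans_le hμ.2).ne'
  have hN : IsCompact (FiniteMeasure.normalize '' (K ∩ {μ | ε ≤ μ.mass})) :=
    hL.image_of_continuousOn fun μ hμ =>
      FiniteMeasure.tendsto_normalize_of_tendsto
        (tendsto_id.mono_left nhdsWithin_le_nhds) (hne μ hμ)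
  have hT := isTightMeasureSet_of_isCompact_closure (hN.isClosed.closure_eq.symm ▸ hN)
  obtain ⟨C, hC, hCle⟩ := isTightMeasureSet_iff_exists_isCompact_measure_compl_le.1 hT
    ((ε / (B + 1) : ℝ≥0) : ℝ≥0∞) (by positivity)
  refine ⟨C, hC, fun μ hμ => ?_⟩
  rcases lt_or_ge μ.mass ε with h | h
  · exact (μ.apply_le_mass _).trans h.le
  · have h1 : μ.normalize Cᶜ ≤ ε / (B + 1) := by
      have := hCle _ ⟨_, mem_image_of_mem _ ⟨hμ, h⟩, rfl⟩
      rwa [← ProbabilityMeasure.ennreal_coeFn_eq_coeFn_toMeasure, ENNReal.coe_le_coe] at this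
    rw [μ.self_eq_mass_mul_normalize]
    calc μ.mass * μ.normalize Cᶜ ≤ (B + 1) * (ε / (B + 1)) := by
          gcongr
          exact (hB μ hμ).trans (by simp)
      _ = ε := mul_div_cancel₀ _ (by positivity)

end Measures

/-! ### The cone of nonnegative measures in the weak space -/

namespace WeakSignedMeasure

variable {X : Type*} [TopologicalSpace X] [MeasurableSpace X] [BorelSpace X]

/-- The inclusion of the finite nonnegative measures into the signed measures. -/
noncomputable def ofFiniteMeasure (μ : FiniteMeasure X) : WeakSignedMeasure X :=
  (μ : Measure X).toSignedMeasure

theorem measurePairing_ofFiniteMeasure (μ : FiniteMeasure X) (f : X →ᵇ ℝ) :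
    measurePairing X (ofFiniteMeasure μ) f = ∫ x, f x ∂(μ : Measure X) := by
  have hflip : (ContinuousLinearMap.lsmul ℝ ℝ : ℝ →L[ℝ] ℝ →L[ℝ] ℝ) =
      (ContinuousLinearMap.lsmul ℝ ℝ).flip := by
    ext
    simp
  have h := VectorMeasure.integral_toSignedMeasure (μ := (μ : Measure X)) (f := f)
  rw [← hflip] at h
  exact h

/-- The positive part of a signed measure, as a finite measure. -/
noncomputable def toFiniteMeasure (ν : WeakSignedMeasure X) : FiniteMeasure X :=
  ⟨ν.toSigned.toJordanDecomposition.posPart, inferInstance⟩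

theorem toFiniteMeasure_ofFiniteMeasure (μ : FiniteMeasure X) :
    (ofFiniteMeasure μ).toFiniteMeasure = μ := by
  let j : JordanDecomposition X := ⟨μ, 0, .zero_right⟩
  have h : (ofFiniteMeasure μ).toSigned = j.toSignedMeasure := by
    simp [j, JordanDecomposition.toSignedMeasure, toSigned, ofFiniteMeasure]
  exact Subtype.ext (congrArg JordanDecomposition.posPart (SignedMeasure.toJordanDecomposition_eq h))

theorem exists_ofFiniteMeasure_eq {ν : WeakSignedMeasure X} (h : 0 ≤ ν.toSigned) :
    ∃ μ : FiniteMeasure X, ofFiniteMeasure μ = ν :=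
  ⟨⟨ν.toSigned.toMeasureOfZeroLE univ .univ ((VectorMeasure.le_restrict_univ_iff_le _ _).2 h),
    inferInstance⟩, SignedMeasure.toMeasureOfZeroLE_toSignedMeasure _ _⟩

theorem ofFiniteMeasure_toFiniteMeasure {ν : WeakSignedMeasure X} (h : 0 ≤ ν.toSigned) :
    ofFiniteMeasure ν.toFiniteMeasure = ν := by
  obtain ⟨μ, rfl⟩ := exists_ofFiniteMeasure_eq h
  rw [toFiniteMeasure_ofFiniteMeasure]

theorem integral_toFiniteMeasure {ν : WeakSignedMeasure X} (h : 0 ≤ ν.toSigned) (f : X →ᵇ ℝ) :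
    ∫ x, f x ∂(ν.toFiniteMeasure : Measure X) = measurePairing X ν f := by
  conv_rhs => rw [← ofFiniteMeasure_toFiniteMeasure h]
  exact (measurePairing_ofFiniteMeasure _ _).symm

theorem continuous_ofFiniteMeasure : Continuous (ofFiniteMeasure (X := X)) :=
  WeakBilin.continuous_of_continuous_eval _ fun f => by
    simpa only [measurePairing_ofFiniteMeasure] using
      FiniteMeasure.continuous_integral_boundedContinuousFunction f

theorem continuous_toFiniteMeasure_restrict {M : Set (WeakSignedMeasure X)}
    (hM : ∀ ν ∈ M, 0 ≤ ν.toSigned) :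
    Continuous fun ν : M => toFiniteMeasure (ν : WeakSignedMeasure X) :=
  FiniteMeasure.continuous_iff_forall_continuous_integral.2 fun f => by
    simp only [fun ν : M => integral_toFiniteMeasure (hM ν ν.2) f]
    exact (WeakBilin.eval_continuous (measurePairing X) f).comp continuous_subtype_val

/-- `ofFiniteMeasure` is a continuous inverse, and the range is the preimage of `M` under it. This
transfers compactness from finite measures to `M`. -/
theorem isClosedEmbedding_toFiniteMeasure_restrict {M : Set (WeakSignedMeasure X)}
    (hM : ∀ ν ∈ M, 0 ≤ ν.toSigned) (hcl : IsClosed M) :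
    IsClosedEmbedding fun ν : M => toFiniteMeasure (ν : WeakSignedMeasure X) := by
  have hleft : ofFiniteMeasure ∘ (fun ν : M => toFiniteMeasure (ν : WeakSignedMeasure X)) =
      Subtype.val := funext fun ν => ofFiniteMeasure_toFiniteMeasure (hM ν ν.2)
  refine ⟨.of_comp (continuous_toFiniteMeasure_restrict hM) continuous_ofFiniteMeasure
    (by rw [hleft]; exact .subtypeVal), ?_⟩
  convert hcl.preimage continuous_ofFiniteMeasure using 1
  ext μ
  constructor
  · rintro ⟨ν, rfl⟩
    simp [ofFiniteMeasure_toFiniteMeasure (hM ν ν.2)]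
  · exact fun h => ⟨⟨_, h⟩, toFiniteMeasure_ofFiniteMeasure μ⟩

theorem variation_toSigned {ν : WeakSignedMeasure X} (h : 0 ≤ ν.toSigned) :
    ν.toSigned.variation = ν.toFiniteMeasure := by
  conv_lhs => rw [← ofFiniteMeasure_toFiniteMeasure h]
  exact Measure.variation_toSignedMeasure

theorem measurePairing_one {ν : WeakSignedMeasure X} (h : 0 ≤ ν.toSigned) :
    measurePairing X ν 1 = ν.toSigned univ := by
  rw [← ofFiniteMeasure_toFiniteMeasure h, measurePairing_ofFiniteMeasure]
  simp only [BoundedContinuousFunction.coe_one, Pi.one_apply, integral_const, smul_eq_mul, mul_one]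
  exact (Measure.toSignedMeasure_apply_measurable .univ).symm

/-- For the converse, testing compares the Jordan parts: the negative one is dominated by the
positive one. The weak closedness of the cone follows. -/
theorem toSigned_nonneg_iff [PseudoMetrizableSpace X] (ν : WeakSignedMeasure X) :
    0 ≤ ν.toSigned ↔ ∀ f : X →ᵇ ℝ, (∀ x, 0 ≤ f x) → 0 ≤ measurePairing X ν f := by
  constructor
  · intro h f hf
    rw [← integral_toFiniteMeasure h]
    exact integral_nonneg hf
  · intro h
    set j := ν.toSigned.toJordanDecomposition
    have hj : ν.toSigned = j.posPart.toSignedMeasure - j.negPart.toSignedMeasure :=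
      (SignedMeasure.toSignedMeasure_toJordanDecomposition _).symm
    have hpair : ∀ f : X →ᵇ ℝ,
        measurePairing X ν f = ∫ x, f x ∂j.posPart - ∫ x, f x ∂j.negPart := by
      intro f
      have h := LinearMap.map_sub₂ (measurePairing X) j.posPart.toSignedMeasure
        j.negPart.toSignedMeasure f
      have h₁ := measurePairing_ofFiniteMeasure ⟨j.posPart, inferInstance⟩ f
      have h₂ := measurePairing_ofFiniteMeasure ⟨j.negPart, inferInstance⟩ f
      rw [← hj] at h
      exact h.trans (congrArg₂ _ h₁ h₂)
    have hle : j.negPart ≤ j.posPart := by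
      refine measure_le_of_forall_lintegral_le fun f => ?_
      let g : X →ᵇ ℝ := f.comp _ NNReal.isometry_coe.lipschitz
      have hg : ∀ x, g x = f x := fun _ => rfl
      have h0 : ∀ x, 0 ≤ g x := fun x => by simp [hg]
      have key : ∀ x, (f x : ℝ≥0∞) = ENNReal.ofReal (g x) := fun x => by simp [hg]
      simp_rw [key]
      rw [← ofReal_integral_eq_lintegral_ofReal (g.integrable _) (.of_forall h0),
        ← ofReal_integral_eq_lintegral_ofReal (g.integrable _) (.of_forall h0)]
      have := h g h0
      rw [hpair] at this
      exact ENNReal.ofReal_le_ofReal (sub_nonneg.1 this)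
    rw [hj]
    intro s hs
    have := (Measure.toSignedMeasure_le_toSignedMeasure_iff _ _).2 hle s hs
    simpa using this

theorem isClosed_setOf_toSigned_nonneg [PseudoMetrizableSpace X] :
    IsClosed {ν : WeakSignedMeasure X | 0 ≤ ν.toSigned} := by
  simp only [toSigned_nonneg_iff, ofPred_forall]
  exact isClosed_iInter fun f => isClosed_iInter fun _ =>
    isClosed_le continuous_const (WeakBilin.eval_continuous (measurePairing X) f)

theorem convex_setOf_toSigned_nonneg : Convex ℝ {ν : WeakSignedMeasure X | 0 ≤ ν.toSigned} := by
  intro ν hν ξ hξ a b ha hb _ s hs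
  have h1 := mul_nonneg ha (hν s hs)
  have h2 := mul_nonneg hb (hξ s hs)
  exact add_nonneg h1 h2

theorem measurePairing_injective [PseudoMetrizableSpace X] :
    Function.Injective (measurePairing X) := by
  refine (injective_iff_map_eq_zero _).2 fun ν hν => ?_
  -- A measure with zero pairings passes the positivity test together with its negative.
  have hpos : 0 ≤ toSigned (X := X) ν := (toSigned_nonneg_iff _).2 fun f _ => by
    erw [hν]; rfl
  have hneg : 0 ≤ toSigned (X := X) (-ν) := (toSigned_nonneg_iff _).2 fun f _ => by
    erw [map_neg, hν]; simp
  exact le_antisymm (neg_nonneg.1 hneg) hpos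

instance [PseudoMetrizableSpace X] : T2Space (WeakSignedMeasure X) :=
  (WeakBilin.isEmbedding measurePairing_injective).t2Space

end WeakSignedMeasure


namespace WeakSignedMeasure

/-! ### Barycenters as averages of measures -/

section Barycenter

variable {X : Type*} [TopologicalSpace X] [MeasurableSpace X] [BorelSpace X]
  [PseudoMetrizableSpace X] {M : Set (WeakSignedMeasure X)}

/-- The tautological kernel from a set of nonnegative measures on `X` to `X`. -/
noncomputable def kernel (hM : ∀ ν ∈ M, 0 ≤ ν.toSigned) : Kernel M X :=
  ⟨fun ν => (toFiniteMeasure (ν : WeakSignedMeasure X) : Measure X),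
    FiniteMeasure.measurable_toMeasure_of_continuous (continuous_toFiniteMeasure_restrict hM)⟩

theorem kernel_apply (hM : ∀ ν ∈ M, 0 ≤ ν.toSigned) (ν : M) :
    kernel hM ν = (toFiniteMeasure (ν : WeakSignedMeasure X) : Measure X) :=
  rfl

theorem integral_kernel (hM : ∀ ν ∈ M, 0 ≤ ν.toSigned) (ν : M) (f : X →ᵇ ℝ) :
    ∫ x, f x ∂kernel hM ν = measurePairing X (ν : WeakSignedMeasure X) f :=
  integral_toFiniteMeasure (hM ν ν.2) f

theorem isFiniteKernel_kernel (hM : ∀ ν ∈ M, 0 ≤ ν.toSigned) {C : ℝ≥0}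
    (hC : ∀ ν ∈ M, ν.toSigned.variation univ ≤ C) : IsFiniteKernel (kernel hM) :=
  ⟨C, ENNReal.coe_lt_top, fun ν => by
    rw [kernel_apply, ← variation_toSigned (hM ν ν.2)]
    exact hC ν ν.2⟩

/-- The integral of `f` as a bounded continuous function of the measure in a bounded set. -/
noncomputable def boundedEval (hM : ∀ ν ∈ M, 0 ≤ ν.toSigned) [IsFiniteKernel (kernel hM)]
    (f : X →ᵇ ℝ) : M →ᵇ ℝ :=
  .ofNormedAddCommGroup (fun ν : M => measurePairing X (ν : WeakSignedMeasure X) f)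
    ((WeakBilin.eval_continuous (measurePairing X) f).comp continuous_subtype_val)
    (‖f‖ * (kernel hM).bound.toReal) fun ν => by
      rw [← integral_kernel hM]
      refine (norm_integral_le_of_norm_le_const (.of_forall f.norm_coe_le_norm)).trans ?_
      gcongr
      exact ENNReal.toReal_mono (kernel hM).bound_ne_top ((kernel hM).measure_le_bound ν univ)

/-- The average of a set of nonnegative measures with respect to a probability measure on it, as
a finite measure. -/
noncomputable def averageMeasure (hM : ∀ ν ∈ M, 0 ≤ ν.toSigned) [IsFiniteKernel (kernel hM)]
    (μ : ProbabilityMeasure M) : FiniteMeasure X :=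
  ⟨kernel hM ∘ₘ (μ : Measure M), inferInstance⟩

theorem toMeasure_averageMeasure (hM : ∀ ν ∈ M, 0 ≤ ν.toSigned) [IsFiniteKernel (kernel hM)]
    (μ : ProbabilityMeasure M) :
    (averageMeasure hM μ : Measure X) = kernel hM ∘ₘ (μ : Measure M) :=
  rfl

/-- The average of a set of nonnegative measures with respect to a probability measure on it, as
a signed measure. -/
noncomputable def average (hM : ∀ ν ∈ M, 0 ≤ ν.toSigned) [IsFiniteKernel (kernel hM)]
    (μ : ProbabilityMeasure M) : WeakSignedMeasure X :=
  ofFiniteMeasure (averageMeasure hM μ)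

theorem integral_measurePairing (hM : ∀ ν ∈ M, 0 ≤ ν.toSigned) [IsFiniteKernel (kernel hM)]
    (μ : ProbabilityMeasure M) (f : X →ᵇ ℝ) :
    ∫ ν : M, measurePairing X (ν : WeakSignedMeasure X) f ∂(μ : Measure M) =
      measurePairing X (average hM μ) f := by
  simp_rw [← integral_kernel hM]
  refine ((measurePairing_ofFiniteMeasure (averageMeasure hM μ) f).trans ?_).symm
  rw [toMeasure_averageMeasure, Measure.comp_eq_comp_const_apply]
  exact Kernel.integral_comp (f.integrable _)

theorem isBarycenter_iff (hM : ∀ ν ∈ M, 0 ≤ ν.toSigned) [IsFiniteKernel (kernel hM)]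
    (μ : ProbabilityMeasure M) (x : WeakSignedMeasure X) :
    IsBarycenter μ x ↔ x = average hM μ := by
  constructor
  · intro h
    refine measurePairing_injective (LinearMap.ext fun f => ?_)
    rw [← integral_measurePairing hM μ f]
    exact (h (WeakBilin.eval (measurePairing X) f)).2.symm
  · rintro rfl ℓ
    obtain ⟨f, rfl⟩ := LinearMap.dualEmbedding_surjective (measurePairing X) ℓ
    exact ⟨(boundedEval hM f).integrable _, integral_measurePairing hM μ f⟩

theorem continuous_average (hM : ∀ ν ∈ M, 0 ≤ ν.toSigned) [IsFiniteKernel (kernel hM)] :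
    Continuous (average hM) := by
  refine WeakBilin.continuous_of_continuous_eval _ fun f => ?_
  simp_rw [← integral_measurePairing hM]
  exact ProbabilityMeasure.continuous_integral_boundedContinuousFunction (boundedEval hM f)

end Barycenter

/-! ### Tightness and compactness of the preimages -/

section Tight

variable {X : Type*} [TopologicalSpace X] [MeasurableSpace X] [BorelSpace X] [PolishSpace X]
  {M : Set (WeakSignedMeasure X)}

/-- A set of probability measures on `M` whose averages stay in a compact set is tight. -/
theorem isTightMeasureSet_of_average_mem (hM : ∀ ν ∈ M, 0 ≤ ν.toSigned) (hcl : IsClosed M)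
    {C : ℝ≥0} (hC : ∀ ν ∈ M, ν.toSigned.variation univ ≤ C) [IsFiniteKernel (kernel hM)]
    {K : Set (WeakSignedMeasure X)} (hK : IsCompact K) (hKpos : ∀ ν ∈ K, 0 ≤ ν.toSigned) :
    IsTightMeasureSet {(μ : Measure M) | μ ∈ {μ : ProbabilityMeasure M | average hM μ ∈ K}} := by
  rw [isTightMeasureSet_iff_exists_isCompact_measure_compl_le]
  intro ε hε
  obtain ⟨δ, hδ, hδε⟩ := ENNReal.exists_pos_sum_of_countable hε.ne' ℕ
  let u : ℕ → ℝ≥0 := fun n => (1 / 2) ^ n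
  have hu : Tendsto u atTop (𝓝 0) := tendsto_pow_atTop_nhds_zero_of_lt_one (by simp) (by norm_num)
  have hupos : ∀ n, 0 < u n := fun n => by positivity
  have hK' : IsCompact (toFiniteMeasure '' K) := by
    have := isCompact_iff_isCompact_univ.1 hK
    rw [image_eq_range]
    simpa using this.image (continuous_toFiniteMeasure_restrict hKpos)
  -- The tail bound `δ n * u n` is chosen so that Markov at level `u n` leaves an exceptional set of
  -- measure at most `δ n`, summable to below `ε`.
  choose S hS hSle using fun n =>
    FiniteMeasure.exists_isCompact_forall_compl_le hK' (mul_pos (hδ n) (hupos n))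
  let T : Set M := (fun ν : M => toFiniteMeasure (ν : WeakSignedMeasure X)) ⁻¹'
    {ξ | ξ.mass ≤ C ∧ ∀ n, ξ (S n)ᶜ ≤ u n}
  have hT : IsCompact T := (isClosedEmbedding_toFiniteMeasure_restrict hM hcl).isCompact_preimage
    (isCompact_setOfPred_finiteMeasure_mass_le_compl_isCompact_le C hu hS (.inl inferInstance))
  have hTc : Tᶜ ⊆ ⋃ n, {ν : M | (u n : ℝ≥0∞) ≤ kernel hM ν (S n)ᶜ} := by
    intro ν hν
    by_contra hcon
    simp only [mem_iUnion, mem_ofPred_eq, not_exists, not_le] at hcon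
    refine hν ⟨?_, fun n => ?_⟩
    · rw [← ENNReal.coe_le_coe, FiniteMeasure.ennreal_mass, ← variation_toSigned (hM ν ν.2)]
      exact hC ν ν.2
    · rw [← ENNReal.coe_le_coe, FiniteMeasure.ennreal_coeFn_eq_coeFn_toMeasure]
      exact (hcon n).le
  refine ⟨T, hT, ?_⟩
  rintro _ ⟨μ, hμ, rfl⟩
  have hbound : ∀ n, (μ : Measure M) {ν : M | (u n : ℝ≥0∞) ≤ kernel hM ν (S n)ᶜ} ≤ δ n := by
    intro n
    have hSm : MeasurableSet (S n)ᶜ := (hS n).isClosed.measurableSet.compl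
    have hmarkov := mul_meas_ge_le_lintegral (μ := (μ : Measure M))
      ((kernel hM).measurable_coe hSm) (u n)
    have htotal : ∫⁻ ν, kernel hM ν (S n)ᶜ ∂(μ : Measure M) ≤ (δ n * u n : ℝ≥0) := by
      have := hSle n _ (mem_image_of_mem _ hμ)
      rw [average, toFiniteMeasure_ofFiniteMeasure, ← ENNReal.coe_le_coe,
        FiniteMeasure.ennreal_coeFn_eq_coeFn_toMeasure] at this
      rwa [toMeasure_averageMeasure, Measure.bind_apply hSm (kernel hM).aemeasurable] at this
    have := hmarkov.trans htotal
    rw [ENNReal.coe_mul, mul_comm] at this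
    exact (ENNReal.mul_le_mul_iff_left (by simpa using (hupos n).ne') ENNReal.coe_ne_top).1 this
  calc (μ : Measure M) Tᶜ
      ≤ ∑' n, (μ : Measure M) {ν : M | (u n : ℝ≥0∞) ≤ kernel hM ν (S n)ᶜ} :=
        (measure_mono hTc).trans (measure_iUnion_le _)
    _ ≤ ∑' n, (δ n : ℝ≥0∞) := ENNReal.tsum_le_tsum hbound
    _ ≤ ε := hδε.le

theorem isMuCompact_of_isClosed (hM : ∀ ν ∈ M, 0 ≤ ν.toSigned) (hcl : IsClosed M)
    {C : ℝ≥0} (hC : ∀ ν ∈ M, ν.toSigned.variation univ ≤ C) : IsMuCompact M where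
  existsUnique_barycenter μ := by
    have := isFiniteKernel_kernel hM hC
    simp [isBarycenter_iff hM]
  barycenter_mem μ x hx := by
    by_contra hcon
    -- A separating functional has integral at most `u` over `M`, yet exceeds `u` at the barycenter.
    obtain ⟨ℓ, u, hℓ, hu⟩ := geometric_hahn_banach_closed_point convex_closedConvexHull
      isClosed_closedConvexHull hcon
    obtain ⟨hint, heq⟩ := hx ℓ
    have hle : ∫ a : M, ℓ (a : WeakSignedMeasure X) ∂(μ : Measure M) ≤ ∫ _ : M, u ∂(μ : Measure M) :=
      integral_mono hint (integrable_const _) fun a => (hℓ _ (subset_closedConvexHull a.2)).le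
    rw [heq] at hle
    simp only [integral_const, probReal_univ, one_smul] at hle
    exact hu.not_ge hle
  isCompact_preimage K hK hKc := by
    have := isFiniteKernel_kernel hM hC
    have hKpos : ∀ ν ∈ K, 0 ≤ ν.toSigned := fun ν hν =>
      closedConvexHull_min hM convex_setOf_toSigned_nonneg isClosed_setOf_toSigned_nonneg (hK hν)
    have hset : {μ : ProbabilityMeasure M | ∃ x ∈ K, IsBarycenter μ x} =
        {μ | average hM μ ∈ K} := by
      ext μ
      simp [isBarycenter_iff hM]
    have hclosed : IsClosed {μ : ProbabilityMeasure M | average hM μ ∈ K} :=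
      hKc.isClosed.preimage (continuous_average hM)
    rw [hset, ← hclosed.closure_eq]
    exact isCompact_closure_of_isTightMeasureSet
      (isTightMeasureSet_of_average_mem hM hcl hC hKc hKpos)

theorem isMuCompact_setOf_isProbability :
    IsMuCompact {ν : WeakSignedMeasure X | 0 ≤ ν.toSigned ∧ ν.toSigned univ = 1} := by
  refine isMuCompact_of_isClosed (C := 1) (fun ν hν => hν.1) ?_ fun ν hν => ?_
  · have : {ν : WeakSignedMeasure X | 0 ≤ ν.toSigned ∧ ν.toSigned univ = 1} =
        {ν : WeakSignedMeasure X | 0 ≤ ν.toSigned} ∩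
          {ν : WeakSignedMeasure X | measurePairing X ν 1 = 1} := by
      ext ν
      exact and_congr_right fun h => by
        rw [mem_ofPred_eq, measurePairing_one (ν := (ν : WeakSignedMeasure X)) h]
    rw [this]
    exact isClosed_setOf_toSigned_nonneg.inter
      (isClosed_eq (WeakBilin.eval_continuous (measurePairing X) 1) continuous_const)
  · have h := measurePairing_one hν.1
    rw [hν.2, ← integral_toFiniteMeasure hν.1] at h
    simp only [BoundedContinuousFunction.coe_one, Pi.one_apply, integral_const, smul_eq_mul,
      mul_one] at h
    rw [variation_toSigned hν.1, ← ENNReal.ofReal_toReal (measure_ne_top _ univ),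
      ← measureReal_def, h]
    simp

end Tight

end WeakSignedMeasure

theorem mainTheorem4 :
    (∀ (X : Type*) [MetricSpace X] [CompleteSpace X] [TopologicalSpace.SeparableSpace X]
      [MeasurableSpace X] [BorelSpace X] (M : Set (WeakSignedMeasure X)),
      (∀ ν ∈ M, 0 ≤ ν.toSigned) →
      IsClosed M →
      (∃ C : ℝ≥0, ∀ ν ∈ M, ν.toSigned.variation univ ≤ C) →
      IsMuCompact M) ∧
    (∀ (X : Type*) [TopologicalSpace X] [PolishSpace X] [MeasurableSpace X] [BorelSpace X],
      IsMuCompact {ν : WeakSignedMeasure X | 0 ≤ ν.toSigned ∧ ν.toSigned univ = 1}) := by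
  refine ⟨?_, ?_⟩
  · intro X _ _ _ _ _ M hM hcl ⟨C, hC⟩
    have : SecondCountableTopology X := UniformSpace.secondCountable_of_separable X
    exact WeakSignedMeasure.isMuCompact_of_isClosed hM hcl hC
  · intro X _ _ _ _
    exact WeakSignedMeasure.isMuCompact_setOf_isProbability
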